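/- Let $\Bbbk$ be an algebraically closed field; all categories and functors are additive and $\Bbbk$-linear. A *2-semicategory* $\mathcal C$ has objects, categories $\mathcal C(i,j)$ of 1-morphisms and 2-morphisms, and strictly associative ($\Bbbk$-bilinear) horizontal composition functors $\mathcal C(j,k)\times\mathcal C(i,j)\to\mathcal C(i,k)$, $(G,F)\mapsto GF$, $(\beta,\alpha)\mapsto\beta\alpha$; identity 1-morphisms are not required. Vertical composition is written $\circ$. A *lax unit* at $i$ is a 1-morphism $I_i\in\mathcal C(i,i)$ with natural transformations $l_F\colon I_iF\to F$ ($F\in\mathcal C(j,i)$) and $r_G\colon GI_i\to G$ ($G\in\mathcal C(i,k)$) such that $\mathrm{id}_G\,l_F=r_G\,\mathrm{id}_F$, $l_{FH}=l_F\,\mathrm{id}_H$ and $r_{KG}=\mathrm{id}_K\,r_G$. An *oplax unit* $I'_i$ is defined dually, with $l'_F\colon F\to I'_iF$ and $r'_G\colon G\to GI'_i$. A *bilax-unital 2-category* is a 2-semicategory with a chosen lax unit $I_i$ and a chosen oplax unit $I'_i$ at every object $i$. It is *finitary* if it has finitely many objects, every $\mathcal C(i,j)$ is finitary (idempotent split,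 finitely many isomorphism classes of indecomposable objects, finite dimensional morphism spaces between indecomposables), and all $I_i$, $I'_i$ are indecomposable. For $F\in\mathcal C(i,j)$ and $G\in\mathcal C(j,i)$, 2-morphisms $\alpha\colon I'_i\to GF$ and $\beta\colon FG\to I_j$ make $(F,G)$ an *adjoint pair* if $l_F\circ(\beta\,\mathrm{id}_F)\circ(\mathrm{id}_F\,\alpha)\circ r'_F=\mathrm{id}_F$ and $r_G\circ(\mathrm{id}_G\,\beta)\circ(\alpha\,\mathrm{id}_G)\circ l'_G=\mathrm{id}_G$. A finitary bilax-unital 2-category $\mathcal C$ is *fiax* if there is an equivalence $(-)^\star\colon\mathcal C\to\mathcal C^{\mathrm{op},\mathrm{op}}$ (the identity on objects, reversing 1- and 2-morphisms, strictly compatible with horizontal composition) such that 1. $(I_i)^\star=I'_i$, $(l_F)^\star=r'_{F^\star}$ and $(r_G)^\star=l'_{G^\star}$; 2. every $F\in\mathcal C(j,i)$ has adjunction morphisms $\alpha_F\colon I'_j\to F^\star F$ and $\beta_F\colon FF^\star\to I_i$ making $(F,F^\star)$ an adjoint pair; 3. with these, for every 2-morphism $\gamma\colon F\to G$ with $F,G\in\mathcal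 C(j,i)$, $\gamma^\star=r_{F^\star}\circ(\mathrm{id}_{F^\star}\beta_G)\circ(\mathrm{id}_{F^\star}\,\gamma\,\mathrm{id}_{G^\star})\circ(\alpha_F\,\mathrm{id}_{G^\star})\circ l'_{G^\star}$; 4. $(-)^{\star\star}\cong\mathrm{Id}_{\mathcal C}$ (an isomorphism natural in 1-morphisms and compatible with horizontal composition). **Proposition.** Let $\mathcal C$ be a fiax category. Then for every object $i$, $$r_{I'_i}\circ l'_{I_i}=l_{I'_i}\circ r'_{I_i}\colon I_i\to I'_i,$$ and also the mirror image of this identity holds, in which both sides are reflected left to right (exchanging $l$ with $r$, $l'$ with $r'$, and reversing horizontal composition): $l_{I'_i}\circ r'_{I_i}=r_{I'_i}\circ l'_{I_i}$. -/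

import Mathlib

open CategoryTheory CategoryTheory.Limits

universe u v w t

/-- A finitary category over `𝕜`: an additive `𝕜`-linear category that is idempotent split, has
finitely many isomorphism classes of indecomposable objects, and has finite dimensional spaces of
morphisms between indecomposable objects. -/
structure IsFinitaryCategory (𝕜 : Type t) [Field 𝕜] (A : Type v) [Category.{w} A] [Preadditive A]
    [Linear 𝕜 A] [HasZeroObject A] [HasBinaryBiproducts A] : Prop where
  idempotents_split : IsIdempotentComplete A
  finite_indecomposables :
    Set.Finite {x : Quotient (isIsomorphicSetoid A) |
      ∃ X : A, Indecomposable X ∧ Quotient.mk (isIsomorphicSetoid A) X = x}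
  finite_hom : ∀ X Y : A, Indecomposable X → Indecomposable Y → FiniteDimensional 𝕜 (X ⟶ Y)

/-- A (small, additive, `𝕜`-linear) 2-semicategory. Objects of `Hom i j` are the 1-morphisms
from `i` to `j`, morphisms of `Hom i j` are the 2-morphisms, and `≫` is the vertical composition
(written in diagrammatic order). The functor `h` is the horizontal composition; it is strictly
associative, and `𝕜`-bilinear on 2-morphisms. No identity 1-morphisms are required. -/
structure TwoSemicategory (𝕜 : Type t) [Field 𝕜] where
  Ob : Type u
  Hom : Ob → Ob → Type v
  [category : ∀ i j, Category.{w} (Hom i j)]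
  [preadditive : ∀ i j, Preadditive (Hom i j)]
  [linear : ∀ i j, Linear 𝕜 (Hom i j)]
  [hasZeroObject : ∀ i j, HasZeroObject (Hom i j)]
  [hasBinaryBiproducts : ∀ i j, HasBinaryBiproducts (Hom i j)]
  /-- horizontal composition -/
  h : ∀ i j k, Hom j k × Hom i j ⥤ Hom i k
  h_assoc : ∀ i j k l,
    (𝟭 (Hom k l)).prod (h i j k) ⋙ h i k l =
      prod.inverseAssociator (Hom k l) (Hom j k) (Hom i j) ⋙
        (h j k l).prod (𝟭 (Hom i j)) ⋙ h i j l
  h_add_left : ∀ {i j k} {G K : Hom j k} {F H : Hom i j} (β β' : G ⟶ K) (α : F ⟶ H),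
    (h i j k).map (Prod.mkHom (β + β') α) =
      (h i j k).map (Prod.mkHom β α) + (h i j k).map (Prod.mkHom β' α)
  h_add_right : ∀ {i j k} {G K : Hom j k} {F H : Hom i j} (β : G ⟶ K) (α α' : F ⟶ H),
    (h i j k).map (Prod.mkHom β (α + α')) =
      (h i j k).map (Prod.mkHom β α) + (h i j k).map (Prod.mkHom β α')
  h_smul_left : ∀ {i j k} {G K : Hom j k} {F H : Hom i j} (c : 𝕜) (β : G ⟶ K) (α : F ⟶ H),
    (h i j k).map (Prod.mkHom (c • β) α) = c • (h i j k).map (Prod.mkHom β α)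
  h_smul_right : ∀ {i j k} {G K : Hom j k} {F H : Hom i j} (c : 𝕜) (β : G ⟶ K) (α : F ⟶ H),
    (h i j k).map (Prod.mkHom β (c • α)) = c • (h i j k).map (Prod.mkHom β α)

namespace TwoSemicategory

attribute [instance] category preadditive linear hasZeroObject hasBinaryBiproducts

/-- The horizontal composite `GF` of 1-morphisms. -/
abbrev comp {𝕜 : Type t} [Field 𝕜] {C : TwoSemicategory.{u, v, w} 𝕜} {i j k : C.Ob}
    (G : C.Hom j k) (F : C.Hom i j) : C.Hom i k :=
  (C.h i j k).obj (G, F)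

/-- The horizontal composite `βα` of 2-morphisms. -/
abbrev hcomp {𝕜 : Type t} [Field 𝕜] {C : TwoSemicategory.{u, v, w} 𝕜} {i j k : C.Ob}
    {G K : C.Hom j k} {F H : C.Hom i j} (β : G ⟶ K) (α : F ⟶ H) :
    comp G F ⟶ comp K H :=
  (C.h i j k).map (Prod.mkHom β α)

end TwoSemicategory

infixr:80 " ⊚ " => TwoSemicategory.comp
infixr:80 " ◫ " => TwoSemicategory.hcomp

namespace TwoSemicategory

theorem comp_assoc {𝕜 : Type t} [Field 𝕜] {C : TwoSemicategory.{u, v, w} 𝕜} {i j k l : C.Ob}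
    (H : C.Hom k l) (G : C.Hom j k) (F : C.Hom i j) : H ⊚ (G ⊚ F) = (H ⊚ G) ⊚ F :=
  Functor.congr_obj (C.h_assoc i j k l) (H, (G, F))

/-- The identity 2-morphism `H(GF) = (HG)F` expressing strict associativity. -/
abbrev assocHom {𝕜 : Type t} [Field 𝕜] {C : TwoSemicategory.{u, v, w} 𝕜} {i j k l : C.Ob}
    (H : C.Hom k l) (G : C.Hom j k) (F : C.Hom i j) : H ⊚ (G ⊚ F) ⟶ (H ⊚ G) ⊚ F :=
  eqToHom (comp_assoc H G F)

/-- The identity 2-morphism `(HG)F = H(GF)` expressing strict associativity. -/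
abbrev assocInv {𝕜 : Type t} [Field 𝕜] {C : TwoSemicategory.{u, v, w} 𝕜} {i j k l : C.Ob}
    (H : C.Hom k l) (G : C.Hom j k) (F : C.Hom i j) : (H ⊚ G) ⊚ F ⟶ H ⊚ (G ⊚ F) :=
  eqToHom (comp_assoc H G F).symm

/-- The functor `h(X, -)` of composing with the 1-morphism `X` on the left. -/
abbrev leftComp {𝕜 : Type t} [Field 𝕜] (C : TwoSemicategory.{u, v, w} 𝕜) {i : C.Ob}
    (X : C.Hom i i) (j : C.Ob) : C.Hom j i ⥤ C.Hom j i :=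
  Prod.sectR X (C.Hom j i) ⋙ C.h j i i

/-- The functor `h(-, X)` of composing with the 1-morphism `X` on the right. -/
abbrev rightComp {𝕜 : Type t} [Field 𝕜] (C : TwoSemicategory.{u, v, w} 𝕜) {i : C.Ob}
    (X : C.Hom i i) (k : C.Ob) : C.Hom i k ⥤ C.Hom i k :=
  Prod.sectL (C.Hom i k) X ⋙ C.h i i k

/-- The data of a lax unit at `i`: a 1-morphism `I` and natural transformations with components
`l_F : I F ⟶ F` and `r_G : G I ⟶ G`. -/
structure LaxUnitData {𝕜 : Type t} [Field 𝕜] (C : TwoSemicategory.{u, v, w} 𝕜) (i : C.Ob) where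
  I : C.Hom i i
  lTrans : ∀ j, C.leftComp I j ⟶ 𝟭 (C.Hom j i)
  rTrans : ∀ k, C.rightComp I k ⟶ 𝟭 (C.Hom i k)

/-- The left unitor `l_F : I F ⟶ F`. -/
def LaxUnitData.l {𝕜 : Type t} [Field 𝕜] {C : TwoSemicategory.{u, v, w} 𝕜} {i : C.Ob}
    (U : LaxUnitData C i) {j : C.Ob} (F : C.Hom j i) : U.I ⊚ F ⟶ F :=
  (U.lTrans j).app F

/-- The right unitor `r_G : G I ⟶ G`. -/
def LaxUnitData.r {𝕜 : Type t} [Field 𝕜] {C : TwoSemicategory.{u, v, w} 𝕜} {i : C.Ob}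
    (U : LaxUnitData C i) {k : C.Ob} (G : C.Hom i k) : G ⊚ U.I ⟶ G :=
  (U.rTrans k).app G

/-- A lax unit at `i`. The axioms are `id_G l_F = r_G id_F`, `l_{FH} = l_F id_H` and
`r_{KG} = id_K r_G`. -/
structure LaxUnit {𝕜 : Type t} [Field 𝕜] (C : TwoSemicategory.{u, v, w} 𝕜) (i : C.Ob)
    extends LaxUnitData C i where
  id_l : ∀ {j k : C.Ob} (F : C.Hom j i) (G : C.Hom i k),
    𝟙 G ◫ toLaxUnitData.l F = assocHom G I F ≫ (toLaxUnitData.r G ◫ 𝟙 F)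
  l_comp : ∀ {m j : C.Ob} (F : C.Hom j i) (H : C.Hom m j),
    toLaxUnitData.l (F ⊚ H) = assocHom I F H ≫ (toLaxUnitData.l F ◫ 𝟙 H)
  r_comp : ∀ {k m : C.Ob} (G : C.Hom i k) (K : C.Hom k m),
    toLaxUnitData.r (K ⊚ G) = assocInv K G I ≫ (𝟙 K ◫ toLaxUnitData.r G)

/-- The data of an oplax unit at `i`: a 1-morphism `I'` and natural transformations with components
`l'_F : F ⟶ I' F` and `r'_G : G ⟶ G I'`. -/
structure OplaxUnitData {𝕜 : Type t} [Field 𝕜] (C : TwoSemicategory.{u, v, w} 𝕜) (i : C.Ob) where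
  I : C.Hom i i
  lTrans : ∀ j, 𝟭 (C.Hom j i) ⟶ C.leftComp I j
  rTrans : ∀ k, 𝟭 (C.Hom i k) ⟶ C.rightComp I k

/-- The left unitor `l'_F : F ⟶ I' F`. -/
def OplaxUnitData.l {𝕜 : Type t} [Field 𝕜] {C : TwoSemicategory.{u, v, w} 𝕜} {i : C.Ob}
    (U : OplaxUnitData C i) {j : C.Ob} (F : C.Hom j i) : F ⟶ U.I ⊚ F :=
  (U.lTrans j).app F

/-- The right unitor `r'_G : G ⟶ G I'`. -/
def OplaxUnitData.r {𝕜 : Type t} [Field 𝕜] {C : TwoSemicategory.{u, v, w} 𝕜} {i : C.Ob}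
    (U : OplaxUnitData C i) {k : C.Ob} (G : C.Hom i k) : G ⟶ G ⊚ U.I :=
  (U.rTrans k).app G

/-- An oplax unit at `i`. The axioms are `id_G l'_F = r'_G id_F`, `l'_{FH} = l'_F id_H` and
`r'_{KG} = id_K r'_G`. -/
structure OplaxUnit {𝕜 : Type t} [Field 𝕜] (C : TwoSemicategory.{u, v, w} 𝕜) (i : C.Ob)
    extends OplaxUnitData C i where
  id_l : ∀ {j k : C.Ob} (F : C.Hom j i) (G : C.Hom i k),
    𝟙 G ◫ toOplaxUnitData.l F = (toOplaxUnitData.r G ◫ 𝟙 F) ≫ assocInv G I F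
  l_comp : ∀ {m j : C.Ob} (F : C.Hom j i) (H : C.Hom m j),
    toOplaxUnitData.l (F ⊚ H) = (toOplaxUnitData.l F ◫ 𝟙 H) ≫ assocInv I F H
  r_comp : ∀ {k m : C.Ob} (G : C.Hom i k) (K : C.Hom k m),
    toOplaxUnitData.r (K ⊚ G) = (𝟙 K ◫ toOplaxUnitData.r G) ≫ assocHom K G I

/-- An equivalence `(-)⋆ : C → C^{op,op}` that is the identity on objects, where `C^{op,op}` is `C`
with both 1- and 2-morphisms reversed: contravariant `𝕜`-linear equivalences
`C(i,j) → C(j,i)` with `(GF)⋆ = F⋆ G⋆` and `(βα)⋆ = α⋆ β⋆`. -/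
structure Duality {𝕜 : Type t} [Field 𝕜] (C : TwoSemicategory.{u, v, w} 𝕜) where
  functor : ∀ i j, (C.Hom i j)ᵒᵖ ⥤ C.Hom j i
  isEquivalence : ∀ i j, (functor i j).IsEquivalence
  map_add : ∀ {i j} {F G : C.Hom i j} (α β : F ⟶ G),
    (functor i j).map (α + β).op = (functor i j).map α.op + (functor i j).map β.op
  map_smul : ∀ {i j} {F G : C.Hom i j} (c : 𝕜) (α : F ⟶ G),
    (functor i j).map (c • α).op = c • (functor i j).map α.op
  obj_comp : ∀ {i j k} (G : C.Hom j k) (F : C.Hom i j),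
    (functor i k).obj (Opposite.op (G ⊚ F)) =
      (functor i j).obj (Opposite.op F) ⊚ (functor j k).obj (Opposite.op G)
  map_hcomp : ∀ {i j k} {G K : C.Hom j k} {F H : C.Hom i j} (β : G ⟶ K) (α : F ⟶ H),
    (functor i k).map (β ◫ α).op =
      eqToHom (obj_comp K H) ≫ ((functor i j).map α.op ◫ (functor j k).map β.op) ≫
        eqToHom (obj_comp G F).symm

namespace Duality

/-- `F⋆` -/
abbrev obj {𝕜 : Type t} [Field 𝕜] {C : TwoSemicategory.{u, v, w} 𝕜} (S : Duality C) {i j : C.Ob}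
    (F : C.Hom i j) : C.Hom j i :=
  (S.functor i j).obj (Opposite.op F)

/-- `γ⋆` -/
abbrev map {𝕜 : Type t} [Field 𝕜] {C : TwoSemicategory.{u, v, w} 𝕜} (S : Duality C) {i j : C.Ob}
    {F G : C.Hom i j} (γ : F ⟶ G) : S.obj G ⟶ S.obj F :=
  (S.functor i j).map γ.op

theorem obj_obj_comp {𝕜 : Type t} [Field 𝕜] {C : TwoSemicategory.{u, v, w} 𝕜} (S : Duality C)
    {i j k : C.Ob} (G : C.Hom j k) (F : C.Hom i j) :
    S.obj (S.obj (G ⊚ F)) = S.obj (S.obj G) ⊚ S.obj (S.obj F) :=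
  (congrArg S.obj (S.obj_comp G F)).trans (S.obj_comp (S.obj F) (S.obj G))

/-- `(-)⋆⋆ ≅ Id_C`: there are isomorphisms `F⋆⋆ ≅ F`, natural in `F` and compatible with
horizontal composition. -/
def IsWeakInvolution {𝕜 : Type t} [Field 𝕜] {C : TwoSemicategory.{u, v, w} 𝕜}
    (S : Duality C) : Prop :=
  ∃ θ : ∀ i j : C.Ob, (S.functor i j).rightOp ⋙ S.functor j i ≅ 𝟭 (C.Hom i j),
    ∀ (i j k : C.Ob) (G : C.Hom j k) (F : C.Hom i j),
      (θ i k).hom.app (G ⊚ F) =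
        eqToHom (S.obj_obj_comp G F) ≫ ((θ j k).hom.app G ◫ (θ i j).hom.app F)

end Duality

end TwoSemicategory

/-- A bilax-unital 2-category: a 2-semicategory with a chosen lax unit and a chosen oplax unit at
each object. -/
structure BilaxUnitalTwoCategory (𝕜 : Type t) [Field 𝕜] extends TwoSemicategory.{u, v, w} 𝕜 where
  lax : ∀ i, toTwoSemicategory.LaxUnit i
  oplax : ∀ i, toTwoSemicategory.OplaxUnit i

namespace BilaxUnitalTwoCategory

open TwoSemicategory

/-- `Iᵢ` -/
abbrev I {𝕜 : Type t} [Field 𝕜] (C : BilaxUnitalTwoCategory.{u, v, w} 𝕜) (i : C.Ob) : C.Hom i i :=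
  (C.lax i).I

/-- `I'ᵢ` -/
abbrev I' {𝕜 : Type t} [Field 𝕜] (C : BilaxUnitalTwoCategory.{u, v, w} 𝕜) (i : C.Ob) : C.Hom i i :=
  (C.oplax i).I

/-- `l_F : Iᵢ F ⟶ F` -/
abbrev l {𝕜 : Type t} [Field 𝕜] (C : BilaxUnitalTwoCategory.{u, v, w} 𝕜) {i j : C.Ob}
    (F : C.Hom j i) : C.I i ⊚ F ⟶ F :=
  (C.lax i).l F

/-- `r_G : G Iᵢ ⟶ G` -/
abbrev r {𝕜 : Type t} [Field 𝕜] (C : BilaxUnitalTwoCategory.{u, v, w} 𝕜) {i k : C.Ob}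
    (G : C.Hom i k) : G ⊚ C.I i ⟶ G :=
  (C.lax i).r G

/-- `l'_F : F ⟶ I'ᵢ F` -/
abbrev l' {𝕜 : Type t} [Field 𝕜] (C : BilaxUnitalTwoCategory.{u, v, w} 𝕜) {i j : C.Ob}
    (F : C.Hom j i) : F ⟶ C.I' i ⊚ F :=
  (C.oplax i).l F

/-- `r'_G : G ⟶ G I'ᵢ` -/
abbrev r' {𝕜 : Type t} [Field 𝕜] (C : BilaxUnitalTwoCategory.{u, v, w} 𝕜) {i k : C.Ob}
    (G : C.Hom i k) : G ⟶ G ⊚ C.I' i :=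
  (C.oplax i).r G

/-- A bilax-unital 2-category is finitary if it has finitely many objects, its categories of
1-morphisms are finitary, and all lax and oplax unit 1-morphisms are indecomposable. -/
structure IsFinitary {𝕜 : Type t} [Field 𝕜] (C : BilaxUnitalTwoCategory.{u, v, w} 𝕜) : Prop where
  finite_ob : Finite C.Ob
  finitary_hom : ∀ i j : C.Ob, IsFinitaryCategory 𝕜 (C.Hom i j)
  indecomposable_I : ∀ i : C.Ob, Indecomposable (C.I i)
  indecomposable_I' : ∀ i : C.Ob, Indecomposable (C.I' i)

/-- `α : I'ᵢ ⟶ GF` and `β : FG ⟶ Iⱼ` are adjunction morphisms making `(F, G)` an adjoint pair: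
`F ⟶ F I'ᵢ ⟶ FGF ⟶ Iⱼ F ⟶ F` and `G ⟶ I'ᵢ G ⟶ GFG ⟶ G Iⱼ ⟶ G` are identities. -/
structure IsAdjunction {𝕜 : Type t} [Field 𝕜] (C : BilaxUnitalTwoCategory.{u, v, w} 𝕜) {i j : C.Ob}
    {F : C.Hom i j} {G : C.Hom j i} (α : C.I' i ⟶ G ⊚ F) (β : F ⊚ G ⟶ C.I j) : Prop where
  left : C.r' F ≫ (𝟙 F ◫ α) ≫ assocHom F G F ≫ (β ◫ 𝟙 F) ≫ C.l F = 𝟙 F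
  right : C.l' G ≫ (α ◫ 𝟙 G) ≫ assocInv G F G ≫ (𝟙 G ◫ β) ≫ C.r G = 𝟙 G

/-- The data exhibiting a bilax-unital 2-category as weakly fiax, apart from being finitary. -/
structure WeaklyFiaxData {𝕜 : Type t} [Field 𝕜] (C : BilaxUnitalTwoCategory.{u, v, w} 𝕜) where
  star : Duality C.toTwoSemicategory
  /-- `(Iᵢ)⋆ = I'ᵢ` -/
  star_I : ∀ i : C.Ob, star.obj (C.I i) = C.I' i
  /-- `(l_F)⋆ = r'_{F⋆}` -/
  star_l : ∀ {i j : C.Ob} (F : C.Hom j i),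
    star.map (C.l F) = C.r' (star.obj F) ≫
      eqToHom ((congrArg (fun X => star.obj F ⊚ X) (star_I i).symm).trans
        (star.obj_comp (C.I i) F).symm)
  /-- `(r_G)⋆ = l'_{G⋆}` -/
  star_r : ∀ {i k : C.Ob} (G : C.Hom i k),
    star.map (C.r G) = C.l' (star.obj G) ≫
      eqToHom ((congrArg (fun X => X ⊚ star.obj G) (star_I i).symm).trans
        (star.obj_comp G (C.I i)).symm)
  α : ∀ {i j : C.Ob} (F : C.Hom j i), C.I' j ⟶ star.obj F ⊚ F
  β : ∀ {i j : C.Ob} (F : C.Hom j i), F ⊚ star.obj F ⟶ C.I i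
  adjunction : ∀ {i j : C.Ob} (F : C.Hom j i), C.IsAdjunction (α F) (β F)
  /-- `γ⋆` is the composite `G⋆ ⟶ I'ⱼ G⋆ ⟶ F⋆ F G⋆ ⟶ F⋆ G G⋆ ⟶ F⋆ Iᵢ ⟶ F⋆`. -/
  star_map : ∀ {i j : C.Ob} {F G : C.Hom j i} (γ : F ⟶ G),
    star.map γ = C.l' (star.obj G) ≫ (α F ◫ 𝟙 (star.obj G)) ≫
      ((𝟙 (star.obj F) ◫ γ) ◫ 𝟙 (star.obj G)) ≫ assocInv (star.obj F) G (star.obj G) ≫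
        (𝟙 (star.obj F) ◫ β G) ≫ C.r (star.obj F)

/-- A fiax category: a finitary bilax-unital 2-category that is weakly fiax by means of an
equivalence `(-)⋆` which is a weak involution. -/
structure IsFiax {𝕜 : Type t} [Field 𝕜] (C : BilaxUnitalTwoCategory.{u, v, w} 𝕜) : Prop where
  finitary : C.IsFinitary
  exists_star : ∃ D : C.WeaklyFiaxData, D.star.IsWeakInvolution

end BilaxUnitalTwoCategory

namespace BilaxUnitalTwoCategory

open TwoSemicategory

variable {𝕜 : Type t} [Field 𝕜] (C : BilaxUnitalTwoCategory.{u, v, w} 𝕜)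

/-! The two maps `I ⟶ I'` become equal after whiskering on the left by any `G : C.Hom i k`: each
then factors as `G I ⟶ G ⟶ G I'`, that is, `C.r G ≫ C.r' G` (`id_hcomp_l'_comp_r`,
`id_hcomp_r'_comp_l`). This uses the unit axioms and naturality alone, without duality. In the
absence of an identity 1-morphism, whiskering need not be faithful. Take `G = I`: naturality of `l`
turns equality of the whiskered maps into equality after precomposition with `C.l I : I I ⟶ I`. That
map can be cancelled because the zigzag identity for the adjoint pair `(I, I⋆)` ends in `C.l I`,
which is therefore a split epimorphism (`IsAdjunction.epi_l`, `eq_of_id_hcomp_eq`). -/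

theorem l_naturality {i j : C.Ob} {F H : C.Hom j i} (γ : F ⟶ H) :
    (𝟙 (C.I i) ◫ γ) ≫ C.l H = C.l F ≫ γ :=
  ((C.lax i).lTrans j).naturality γ

theorem r_naturality {i k : C.Ob} {G K : C.Hom i k} (γ : G ⟶ K) :
    (γ ◫ 𝟙 (C.I i)) ≫ C.r K = C.r G ≫ γ :=
  ((C.lax i).rTrans k).naturality γ

theorem r'_naturality {i k : C.Ob} {G K : C.Hom i k} (γ : G ⟶ K) :
    γ ≫ C.r' K = C.r' G ≫ (γ ◫ 𝟙 (C.I' i)) :=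
  ((C.oplax i).rTrans k).naturality γ

theorem id_hcomp_comp {i j k : C.Ob} (G : C.Hom j k) {F H K : C.Hom i j} (γ : F ⟶ H) (δ : H ⟶ K) :
    𝟙 G ◫ (γ ≫ δ) = (𝟙 G ◫ γ) ≫ (𝟙 G ◫ δ) := by
  rw [hcomp, hcomp, hcomp, ← Functor.map_comp]
  congr 1
  -- In the first coordinate, `𝟙 G` is rewritten as `𝟙 G ≫ 𝟙 G`.
  exact Prod.ext (Category.comp_id _).symm rfl

/-- Whiskering `I ⟶ I' I ⟶ I'` on the left by `G` gives `G I ⟶ G ⟶ G I'`. -/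
theorem id_hcomp_l'_comp_r {i k : C.Ob} (G : C.Hom i k) :
    𝟙 G ◫ (C.l' (C.I i) ≫ C.r (C.I' i)) = C.r G ≫ C.r' G := by
  have h₁ : 𝟙 G ◫ C.l' (C.I i) = (C.r' G ◫ 𝟙 (C.I i)) ≫ assocInv G (C.I' i) (C.I i) :=
    (C.oplax i).id_l (C.I i) G
  have h₂ : C.r (G ⊚ C.I' i) = assocInv G (C.I' i) (C.I i) ≫ (𝟙 G ◫ C.r (C.I' i)) :=
    (C.lax i).r_comp (C.I' i) G
  -- The associator left by `h₁` is absorbed into `C.r (G ⊚ C.I' i)` by `h₂`; what remains is the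
  -- naturality square of `r` at `C.r' G`.
  rw [id_hcomp_comp, h₁, Category.assoc, ← h₂, r_naturality]

/-- Whiskering `I ⟶ I I' ⟶ I'` on the left by `G` gives `G I ⟶ G ⟶ G I'`. -/
theorem id_hcomp_r'_comp_l {i k : C.Ob} (G : C.Hom i k) :
    𝟙 G ◫ (C.r' (C.I i) ≫ C.l (C.I' i)) = C.r G ≫ C.r' G := by
  have h₁ : C.r' (G ⊚ C.I i) = (𝟙 G ◫ C.r' (C.I i)) ≫ assocHom G (C.I i) (C.I' i) :=
    (C.oplax i).r_comp (C.I i) G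
  have h₂ : 𝟙 G ◫ C.l (C.I' i) = assocHom G (C.I i) (C.I' i) ≫ (C.r G ◫ 𝟙 (C.I' i)) :=
    (C.lax i).id_l (C.I' i) G
  -- Dually, the remaining square is naturality of `r'` at `C.r G`.
  rw [id_hcomp_comp, h₂, ← Category.assoc, ← h₁, ← r'_naturality]

/-- The left unitor of a 1-morphism having a right adjoint is a split epimorphism. -/
theorem IsAdjunction.epi_l {C : BilaxUnitalTwoCategory.{u, v, w} 𝕜} {i j : C.Ob} {F : C.Hom i j}
    {G : C.Hom j i} {α : C.I' i ⟶ G ⊚ F} {β : F ⊚ G ⟶ C.I j} (h : C.IsAdjunction α β) :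
    Epi (C.l F) := by
  have : IsSplitEpi (C.l F) :=
    -- The section is the zigzag for `F` with its last factor `C.l F` removed.
    ⟨⟨C.r' F ≫ (𝟙 F ◫ α) ≫ assocHom F G F ≫ (β ◫ 𝟙 F), by
      simpa only [Category.assoc] using h.left⟩⟩
  infer_instance

/-- A 2-morphism out of a 1-morphism with epimorphic left unitor is determined by its whiskering
with the lax unit. -/
theorem eq_of_id_hcomp_eq {i j : C.Ob} {F H : C.Hom j i} [Epi (C.l F)] {γ δ : F ⟶ H}
    (h : 𝟙 (C.I i) ◫ γ = 𝟙 (C.I i) ◫ δ) : γ = δ := by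
  rw [← cancel_epi (C.l F), ← l_naturality, ← l_naturality, h]

end BilaxUnitalTwoCategory

/-- In a fiax category, at each object `i`, the 2-morphisms `I ⟶ I' I ⟶ I'` and `I ⟶ I I' ⟶ I'`
agree; the second conjunct is the equality obtained by reflecting both sides left to right, which
exchanges left and right unitors and the order of horizontal composition. -/
theorem mainTheorem8 {𝕜 : Type t} [Field 𝕜] [IsAlgClosed 𝕜]
    (C : BilaxUnitalTwoCategory.{u, v, w} 𝕜) (hC : C.IsFiax) (i : C.Ob) :
    (C.l' (C.I i) ≫ C.r (C.I' i) = C.r' (C.I i) ≫ C.l (C.I' i)) ∧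
      (C.r' (C.I i) ≫ C.l (C.I' i) = C.l' (C.I i) ≫ C.r (C.I' i)) := by
  obtain ⟨D, -⟩ := hC.exists_star
  have := (D.adjunction (C.I i)).epi_l
  have h : C.l' (C.I i) ≫ C.r (C.I' i) = C.r' (C.I i) ≫ C.l (C.I' i) :=
    -- Here `I` plays two roles: it is the whiskering 1-morphism `G`, and it is the source whose
    -- left unitor is cancelled.
    C.eq_of_id_hcomp_eq ((C.id_hcomp_l'_comp_r (C.I i)).trans (C.id_hcomp_r'_comp_l (C.I i)).symm)
  -- Reflection interchanges the two composites, so the mirror identity is the same equation read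
  -- backwards.
  exact ⟨h, h.symm⟩
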